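/- For integers $s\ge 2$ and $t\ge 1$ put $$\zeta(s)=\sum_{n\ge 1}\frac1{n^s},\qquad \lambda(s)=\sum_{n\ge 1}\frac1{(2n-1)^s},\qquad \sigma(s,t)=\sum_{n\ge 1}\Big(1+\frac1{3^t}+\cdots+\frac1{(2n-1)^t}\Big)\frac1{n^s}.$$ Then for every integer $a\ge 2$ the series $\sigma(2a-1,2)$ converges and $$\sigma(2a-1,2)=-a\,2^{2a-1}\lambda(2a+1)+\frac{2^{2a-1}(2a+1)}{3}\,\lambda(2)\lambda(2a-1)+\sum_{j=1}^{a-2}j\,2^{2j}\lambda(2j+1)\,\zeta(2a-2j),$$ where the last sum is empty (equal to $0$) for $a=2$. -/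

import Mathlib

noncomputable section

/-- `ζ(s) = ∑_{n ≥ 1} 1 / n ^ s` as a real series, for integers `s ≥ 2`. -/
def zetaSeries (s : ℕ) : ℝ := ∑' n : ℕ, 1 / ((n : ℝ) + 1) ^ s

/-- `λ(s) = ∑_{n ≥ 1} 1 / (2 n - 1) ^ s`, for integers `s ≥ 2`;
the index is shifted by one, so that `2 (n + 1) - 1 = 2 n + 1`. -/
def lambdaSeries (s : ℕ) : ℝ := ∑' n : ℕ, 1 / (2 * (n : ℝ) + 1) ^ s

/-- `S_n^{(t)} = ∑_{k = 1}^{n} 1 / (2 k - 1) ^ t`. -/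
def semiHarmonic (t n : ℕ) : ℝ := ∑ k ∈ Finset.Icc 1 n, 1 / (2 * (k : ℝ) - 1) ^ t

/-- The term of index `n + 1` of the series `σ(s, t)`, namely `S_{n+1}^{(t)} / (n + 1) ^ s`. -/
def sigmaTerm (s t n : ℕ) : ℝ := semiHarmonic t (n + 1) / ((n : ℝ) + 1) ^ s

/-- `σ(s, t) = ∑_{n ≥ 1} S_n^{(t)} / n ^ s`. -/
def sigmaSum (s t : ℕ) : ℝ := ∑' n : ℕ, sigmaTerm s t n

end

/-!
Put `p = m + 1/2` and `q = n + 1`, so that `∑ₘ p⁻ˢ = 2ˢ λ(s)` and `∑ₙ q⁻ˢ = ζ(s)`. With `k = a - 1`,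
the products `λ(2j+1) ζ(2k+2-2j)` weighted by `j` come from a double series over `(p, q)` whose
terms are the weighted geometric sums `∑ⱼ j p^(-2j-1) q^(2j-2k-2)`. In closed form such a sum is
`(k+1) p^(-2k-1) / (q² - p²) - p^(-2k-1) q² / (q² - p²)² + q^(-2k) p / (q² - p²)²`.
The middle term is summed over `q` first: `∑ q² / (q² - p²)²` is a bilateral series over the
half-integers and equals `2 λ(2)` for every `p`. The last term is summed over `p` first:
`∑ p / (q² - p²)² = 2 S_q / q`, which produces `2 σ(2k+1, 2)`. What is left is then summed over `q`
first: `∑ 1 / (q² - p²) = 1 / (2p²)`, the cotangent expansion at a zero of the cotangent. Comparing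
the sums gives the theorem once the top term `j = k` is rewritten with `ζ(2) = (4/3) λ(2)`.
-/

open Finset

section PartialFractions

lemma sub_sq_mul_sum_natCast_mul_pow_mul_pow {R : Type*} [CommRing R] (x y : R) (k : ℕ) :
    (x - y) ^ 2 * ∑ j ∈ Icc 1 k, (j : R) * (x ^ j * y ^ (k - j)) =
      k * x ^ (k + 2) - (k + 1) * x ^ (k + 1) * y + x * y ^ (k + 1) := by
  induction k with
  | zero => simp only [zero_lt_one, Icc_eq_empty_of_lt, sum_empty]; ring
  | succ k ih =>
    have factor_out : ∑ j ∈ Icc 1 k, (j : R) * (x ^ j * y ^ (k + 1 - j)) =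
        (∑ j ∈ Icc 1 k, (j : R) * (x ^ j * y ^ (k - j))) * y := by
      rw [sum_mul]
      refine sum_congr rfl fun j hj => ?_
      rw [Nat.sub_add_comm (mem_Icc.1 hj).2, pow_succ]
      ring
    rw [sum_Icc_succ_top (by omega), factor_out, mul_add, ← mul_assoc, ih]
    simp only [Nat.sub_self, Nat.cast_succ]
    ring

variable {K : Type*} [Field K] {p q : K}

lemma sum_natCast_mul_one_div_pow_mul_one_div_pow (hp : p ≠ 0) (hq : q ≠ 0)
    (hpq : q ^ 2 - p ^ 2 ≠ 0) (k : ℕ) :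
    ∑ j ∈ Icc 1 k, (j : K) * (1 / p ^ (2 * j + 1) * (1 / q ^ (2 * (k + 1) - 2 * j))) =
      (k + 1) / p ^ (2 * k + 1) * (1 / (q ^ 2 - p ^ 2))
      - 1 / p ^ (2 * k + 1) * (q ^ 2 / (q ^ 2 - p ^ 2) ^ 2)
      + 1 / q ^ (2 * k) * (p / (q ^ 2 - p ^ 2) ^ 2) := by
  have as_geometric : ∑ j ∈ Icc 1 k,
      (j : K) * (1 / p ^ (2 * j + 1) * (1 / q ^ (2 * (k + 1) - 2 * j))) =
      (∑ j ∈ Icc 1 k, (j : K) * ((1 / p ^ 2) ^ j * (1 / q ^ 2) ^ (k - j))) * (1 / (p * q ^ 2)) := by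
    rw [sum_mul]
    refine sum_congr rfl fun j hj => ?_
    have hjk : 2 * (k + 1) - 2 * j = 2 * (k - j) + 2 := by have := mem_Icc.1 hj; omega
    rw [hjk, div_pow, div_pow, one_pow, one_pow, ← pow_mul, ← pow_mul, pow_succ p, pow_add q]
    field_simp
  have hsub : 1 / p ^ 2 - 1 / q ^ 2 = (q ^ 2 - p ^ 2) / (p ^ 2 * q ^ 2) := by field_simp
  have hne : ((q ^ 2 - p ^ 2) / (p ^ 2 * q ^ 2)) ^ 2 ≠ 0 := by simp [hp, hq, hpq]
  have closed_form := sub_sq_mul_sum_natCast_mul_pow_mul_pow (1 / p ^ 2) (1 / q ^ 2) k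
  rw [hsub] at closed_form
  rw [as_geometric, eq_div_of_mul_eq hne ((mul_comm _ _).trans closed_form)]
  simp only [one_div_pow, ← pow_mul]
  field_simp
  ring

lemma four_mul_sq_div_sq_sub_sq_sq (hpq : q ^ 2 - p ^ 2 ≠ 0) :
    4 * (q ^ 2 / (q ^ 2 - p ^ 2) ^ 2) =
      1 / (q + p) ^ 2 + 1 / (q - p) ^ 2 + 2 * (1 / (q ^ 2 - p ^ 2)) := by
  rw [sq_sub_sq] at hpq ⊢
  obtain ⟨hadd, hsub⟩ := mul_ne_zero_iff.1 hpq
  field_simp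
  ring

lemma four_mul_mul_div_sq_sub_sq_sq (hpq : q ^ 2 - p ^ 2 ≠ 0) :
    4 * q * (p / (q ^ 2 - p ^ 2) ^ 2) = 1 / (p - q) ^ 2 - 1 / (p + q) ^ 2 := by
  rw [sub_sq_comm p q, add_comm p q]
  rw [sq_sub_sq] at hpq ⊢
  obtain ⟨hadd, hsub⟩ := mul_ne_zero_iff.1 hpq
  field_simp
  ring

end PartialFractions

section Series

variable {s t : ℕ}

lemma hasSum_zetaSeries (hs : 2 ≤ s) :
    HasSum (fun n : ℕ => 1 / ((n : ℝ) + 1) ^ s) (zetaSeries s) := by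
  have h := (summable_nat_add_iff 1).2 (Real.summable_one_div_nat_pow.2 hs)
  push_cast at h
  exact h.hasSum

lemma hasSum_lambdaSeries (hs : 2 ≤ s) :
    HasSum (fun n : ℕ => 1 / (2 * (n : ℝ) + 1) ^ s) (lambdaSeries s) := by
  refine Summable.hasSum <| (hasSum_zetaSeries hs).summable.of_nonneg_of_le
    (fun n => by positivity) fun n => ?_
  gcongr
  linarith [n.cast_nonneg (α := ℝ)]

lemma lambdaSeries_add_zetaSeries_div_two_pow (hs : 2 ≤ s) :
    lambdaSeries s + zetaSeries s / 2 ^ s = zetaSeries s := by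
  refine (HasSum.even_add_odd (f := fun n : ℕ => 1 / ((n : ℝ) + 1) ^ s) ?_ ?_).unique
    (hasSum_zetaSeries hs)
  · simpa using hasSum_lambdaSeries hs
  · convert! (hasSum_zetaSeries hs).div_const (2 ^ s) using 2 with n
    rw [div_div, ← mul_pow]
    push_cast
    ring

lemma hasSum_one_div_add_half_pow (hs : 2 ≤ s) :
    HasSum (fun m : ℕ => 1 / ((m : ℝ) + 1 / 2) ^ s) (2 ^ s * lambdaSeries s) := by
  convert! (hasSum_lambdaSeries hs).mul_left (2 ^ s) using 2 with m
  rw [show 2 * (m : ℝ) + 1 = 2 * (m + 1 / 2) by ring, mul_pow]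
  field_simp

lemma hasSum_int_one_div_add_half_pow (hs : 2 ≤ s) (hs_even : Even s) :
    HasSum (fun i : ℤ => 1 / ((i : ℝ) + 1 / 2) ^ s) (2 * (2 ^ s * lambdaSeries s)) := by
  rw [two_mul]
  refine HasSum.of_nat_of_neg_add_one ?_ ?_
  · simpa using hasSum_one_div_add_half_pow hs
  · convert! hasSum_one_div_add_half_pow hs using 2 with n
    rw [← hs_even.neg_pow]
    push_cast
    ring

lemma two_pow_mul_semiHarmonic (t n : ℕ) :
    2 ^ t * semiHarmonic t n = ∑ i ∈ range n, 1 / ((i : ℝ) + 1 / 2) ^ t := by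
  rw [semiHarmonic, ← Ico_add_one_right_eq_Icc, sum_Ico_eq_sum_range,
    add_tsub_cancel_right, mul_sum]
  refine sum_congr rfl fun i _ => ?_
  rw [show 2 * ((1 + i : ℕ) : ℝ) - 1 = 2 * (i + 1 / 2) by push_cast; ring, mul_pow]
  field_simp

lemma hasSum_one_div_add_half_add_pow (ht : 2 ≤ t) (n : ℕ) :
    HasSum (fun m : ℕ => 1 / ((m : ℝ) + 1 / 2 + n) ^ t)
      (2 ^ t * (lambdaSeries t - semiHarmonic t n)) := by
  rw [mul_sub, two_pow_mul_semiHarmonic]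
  convert! (hasSum_nat_add_iff' n).2 (hasSum_one_div_add_half_pow ht) using 2 with m
  push_cast
  ring

lemma hasSum_one_div_add_half_sub_pow (ht : 2 ≤ t) (ht_even : Even t) (n : ℕ) :
    HasSum (fun m : ℕ => 1 / ((m : ℝ) + 1 / 2 - n) ^ t)
      (2 ^ t * (lambdaSeries t + semiHarmonic t n)) := by
  have reflected : ∑ m ∈ range n, 1 / ((m : ℝ) + 1 / 2 - n) ^ t = 2 ^ t * semiHarmonic t n := by
    rw [two_pow_mul_semiHarmonic, ← sum_range_reflect]
    refine sum_congr rfl fun m hm => ?_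
    rw [← ht_even.neg_pow, Nat.sub_sub, Nat.cast_sub (by have := mem_range.1 hm; omega)]
    push_cast
    ring
  rw [← hasSum_nat_add_iff' n, reflected, mul_add, add_sub_cancel_right]
  convert! hasSum_one_div_add_half_pow ht using 2 with m
  push_cast
  ring

lemma semiHarmonic_le_lambdaSeries (ht : 2 ≤ t) (n : ℕ) : semiHarmonic t n ≤ lambdaSeries t := by
  have h := (hasSum_one_div_add_half_add_pow ht n).nonneg fun _ => by positivity
  exact sub_nonneg.1 (nonneg_of_mul_nonneg_right h (by positivity))

lemma semiHarmonic_nonneg (t n : ℕ) : 0 ≤ semiHarmonic t n := by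
  refine nonneg_of_mul_nonneg_right (a := 2 ^ t) ?_ (by positivity)
  rw [two_pow_mul_semiHarmonic]
  positivity

lemma summable_sigmaTerm (hs : 2 ≤ s) (ht : 2 ≤ t) : Summable (sigmaTerm s t) := by
  refine ((hasSum_zetaSeries hs).summable.mul_left (lambdaSeries t)).of_nonneg_of_le
    (fun n => div_nonneg (semiHarmonic_nonneg t _) (by positivity)) fun n => ?_
  rw [mul_one_div]
  exact div_le_div_of_nonneg_right (semiHarmonic_le_lambdaSeries ht _) (by positivity)

end Series

section RowsAndColumns

open Complex in
lemma hasSum_one_div_sq_sub_sq_of_mem_integerComplement {x : ℂ} (hx : x ∈ integerComplement) :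
    HasSum (fun n : ℕ => 1 / (((n : ℂ) + 1) ^ 2 - x ^ 2))
      ((1 / x - Real.pi * cot (Real.pi * x)) / (2 * x)) := by
  have hx0 : x ≠ 0 := integerComplement.ne_zero hx
  have h : HasSum (cotTerm x) (Real.pi * cot (Real.pi * x) - 1 / x) :=
    cot_series_rep' hx ▸ (summable_cotTerm hx).hasSum
  convert! h.neg.div_const (2 * x) using 1
  · ext n
    rw [cotTerm_identity hx, ← sq_sub_sq, neg_div,
      mul_div_cancel_left₀ _ (mul_ne_zero two_ne_zero hx0), ← div_neg, neg_sub]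
  · rw [neg_sub]

lemma natCast_add_half_mem_integerComplement (m : ℕ) :
    (m : ℂ) + 1 / 2 ∈ Complex.integerComplement := by
  rintro ⟨i, hi⟩
  have h : ((2 * i : ℤ) : ℂ) = ((2 * m + 1 : ℤ) : ℂ) := by
    push_cast
    rw [hi]
    ring
  have := Int.cast_injective h
  omega

lemma cot_pi_mul_natCast_add_half (m : ℕ) : Complex.cot (Real.pi * ((m : ℂ) + 1 / 2)) = 0 := by
  have hcos : Complex.cos (Real.pi * ((m : ℂ) + 1 / 2)) = 0 :=
    Complex.cos_eq_zero_iff.2 ⟨m, by push_cast; ring⟩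
  rw [Complex.cot, hcos, zero_div]

lemma sq_add_one_sub_sq_add_half_ne_zero (m n : ℕ) :
    ((n : ℝ) + 1) ^ 2 - ((m : ℝ) + 1 / 2) ^ 2 ≠ 0 := by
  have h := Complex.integerComplement_pow_two_ne_pow_two
    (natCast_add_half_mem_integerComplement m) (n + 1)
  rw [← Complex.ofReal_ne_zero]
  push_cast at h ⊢
  exact sub_ne_zero.2 h.symm

lemma hasSum_one_div_sq_sub_sq (m : ℕ) :
    HasSum (fun n : ℕ => 1 / (((n : ℝ) + 1) ^ 2 - ((m : ℝ) + 1 / 2) ^ 2))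
      (1 / (2 * ((m : ℝ) + 1 / 2) ^ 2)) := by
  have h := hasSum_one_div_sq_sub_sq_of_mem_integerComplement
    (natCast_add_half_mem_integerComplement m)
  rw [cot_pi_mul_natCast_add_half, mul_zero, sub_zero, div_div] at h
  rw [← Complex.hasSum_ofReal]
  push_cast
  convert! h using 2
  ring

lemma hasSum_sq_div_sq_sub_sq_sq (m : ℕ) :
    HasSum (fun n : ℕ => ((n : ℝ) + 1) ^ 2 / (((n : ℝ) + 1) ^ 2 - ((m : ℝ) + 1 / 2) ^ 2) ^ 2)
      (2 * lambdaSeries 2) := by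
  have bilateral : HasSum (fun i : ℤ => 1 / ((i : ℝ) + m + 1 / 2) ^ 2) (8 * lambdaSeries 2) := by
    convert! (Equiv.addRight (m : ℤ)).hasSum_iff.2
      (hasSum_int_one_div_add_half_pow le_rfl even_two) using 1
    · ext i
      simp
    · ring
  have without_center := (hasSum_nat_add_iff' 1).2 bilateral.nat_add_neg
  convert! (without_center.add ((hasSum_one_div_sq_sub_sq m).mul_left 2)).div_const 4 using 1
  · ext n
    rw [eq_div_iff four_ne_zero, mul_comm,
      four_mul_sq_div_sq_sub_sq_sq (sq_add_one_sub_sq_add_half_ne_zero m n)]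
    push_cast
    ring
  · simp only [sum_range_one, Nat.cast_zero, neg_zero, Int.cast_zero, Int.cast_natCast, zero_add,
      mul_inv_rev, one_div]
    ring

lemma hasSum_div_sq_sub_sq_sq (n : ℕ) :
    HasSum (fun m : ℕ => ((m : ℝ) + 1 / 2) / (((n : ℝ) + 1) ^ 2 - ((m : ℝ) + 1 / 2) ^ 2) ^ 2)
      (2 * semiHarmonic 2 (n + 1) / (n + 1)) := by
  have hq : 4 * ((n : ℝ) + 1) ≠ 0 := by positivity
  convert! ((hasSum_one_div_add_half_sub_pow le_rfl even_two (n + 1)).sub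
    (hasSum_one_div_add_half_add_pow le_rfl (n + 1))).div_const (4 * ((n : ℝ) + 1)) using 1
  · ext m
    rw [eq_div_iff hq, mul_comm,
      four_mul_mul_div_sq_sub_sq_sq (sq_add_one_sub_sq_add_half_ne_zero m n)]
    push_cast
    rfl
  · field_simp
    ring

end RowsAndColumns

section DoubleSeries

lemma hasSum_prod_of_nonneg {β γ : Type*} {f : β × γ → ℝ} {g : β → ℝ} {c : ℝ} (hf : 0 ≤ f)
    (hrow : ∀ b, HasSum (fun x => f (b, x)) (g b)) (hg : HasSum g c) : HasSum f c := by
  have hs : Summable f := (summable_prod_of_nonneg hf).2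
    ⟨fun b => (hrow b).summable, by simpa only [(hrow _).tsum_eq] using hg.summable⟩
  exact (hs.hasSum.prod_fiberwise hrow).unique hg ▸ hs.hasSum

lemma hasSum_prod_sq_div_sq_sub_sq_sq {s : ℕ} (hs : 2 ≤ s) :
    HasSum (fun x : ℕ × ℕ => 1 / ((x.1 : ℝ) + 1 / 2) ^ s *
      (((x.2 : ℝ) + 1) ^ 2 / (((x.2 : ℝ) + 1) ^ 2 - ((x.1 : ℝ) + 1 / 2) ^ 2) ^ 2))
      (2 ^ s * lambdaSeries s * (2 * lambdaSeries 2)) := by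
  refine hasSum_prod_of_nonneg (fun x => ?_) (fun m => ?_)
    ((hasSum_one_div_add_half_pow hs).mul_right (2 * lambdaSeries 2))
  · simp only [Pi.zero_apply]
    positivity
  · exact (hasSum_sq_div_sq_sub_sq_sq m).mul_left _

lemma hasSum_prod_div_sq_sub_sq_sq {s : ℕ} (hs : 1 ≤ s) :
    HasSum (fun x : ℕ × ℕ => 1 / ((x.2 : ℝ) + 1) ^ s *
      (((x.1 : ℝ) + 1 / 2) / (((x.2 : ℝ) + 1) ^ 2 - ((x.1 : ℝ) + 1 / 2) ^ 2) ^ 2))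
      (2 * sigmaSum (s + 1) 2) := by
  rw [← (Equiv.prodComm ℕ ℕ).hasSum_iff]
  refine hasSum_prod_of_nonneg (fun x => ?_) (fun n => ?_)
    ((summable_sigmaTerm (Nat.succ_le_succ hs) le_rfl).hasSum.mul_left 2)
  · simp only [Pi.zero_apply, Function.comp_apply]
    positivity
  · convert! (hasSum_div_sq_sub_sq_sq n).mul_left (1 / ((n : ℝ) + 1) ^ s) using 1
    rw [sigmaTerm, pow_succ]
    field_simp

lemma hasSum_prod_sum_one_div_pow (k : ℕ) :
    HasSum (fun x : ℕ × ℕ => ∑ j ∈ Icc 1 k, (j : ℝ) *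
      (1 / ((x.1 : ℝ) + 1 / 2) ^ (2 * j + 1) * (1 / ((x.2 : ℝ) + 1) ^ (2 * (k + 1) - 2 * j))))
      (2 * ∑ j ∈ Icc 1 k,
        (j : ℝ) * 2 ^ (2 * j) * lambdaSeries (2 * j + 1) * zetaSeries (2 * (k + 1) - 2 * j)) := by
  rw [mul_sum]
  refine hasSum_sum fun j hj => ?_
  obtain ⟨hj1, hjk⟩ := mem_Icc.1 hj
  have hp := hasSum_one_div_add_half_pow (s := 2 * j + 1) (by omega)
  have hq := hasSum_zetaSeries (s := 2 * (k + 1) - 2 * j) (by omega)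
  have hpq := hp.mul hq (hp.summable.mul_of_nonneg hq.summable (fun _ => by positivity)
    fun _ => by positivity)
  convert! hpq.mul_left (j : ℝ) using 1
  ring

lemma sigmaSum_two_mul_add_one_two {k : ℕ} (hk : 1 ≤ k) :
    sigmaSum (2 * k + 1) 2 =
      2 ^ (2 * k + 1) * lambdaSeries (2 * k + 1) * lambdaSeries 2
      - (k + 1) * 2 ^ (2 * k + 1) * lambdaSeries (2 * k + 3)
      + ∑ j ∈ Icc 1 k,
        (j : ℝ) * 2 ^ (2 * j) * lambdaSeries (2 * j + 1) * zetaSeries (2 * (k + 1) - 2 * j) := by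
  have remainder := ((hasSum_prod_sum_one_div_pow k).add
    (hasSum_prod_sq_div_sq_sub_sq_sq (s := 2 * k + 1) (by omega))).sub
    (hasSum_prod_div_sq_sub_sq_sq (s := 2 * k) (by omega))
  have remainder_row (m : ℕ) := (hasSum_one_div_sq_sub_sq m).mul_left
    (((k : ℝ) + 1) / ((m : ℝ) + 1 / 2) ^ (2 * k + 1))
  have remainder_by_rows := remainder.prod_fiberwise fun m => by
    convert! remainder_row m using 2 with n
    dsimp only
    rw [sum_natCast_mul_one_div_pow_mul_one_div_pow (by positivity) (by positivity)
      (sq_add_one_sub_sq_add_half_ne_zero m n)]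
    ring
  have row_sums := (hasSum_one_div_add_half_pow (s := 2 * k + 3) (by omega)).mul_left
    (((k : ℝ) + 1) / 2)
  have h := remainder_by_rows.unique (by
    convert! row_sums using 2 with m
    rw [pow_add _ (2 * k) 3, pow_succ]
    field_simp)
  have two_pow : (2 : ℝ) ^ (2 * k + 3) = 4 * 2 ^ (2 * k + 1) := by ring
  rw [two_pow] at h
  linarith

end DoubleSeries

theorem mainTheorem7 (a : ℕ) (ha : 2 ≤ a) :
    Summable (sigmaTerm (2 * a - 1) 2) ∧
    sigmaSum (2 * a - 1) 2 =
      -((a : ℝ) * 2 ^ (2 * a - 1) * lambdaSeries (2 * a + 1))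
      + (2 : ℝ) ^ (2 * a - 1) * (2 * (a : ℝ) + 1) / 3 * lambdaSeries 2 * lambdaSeries (2 * a - 1)
      + ∑ j ∈ Finset.Icc 1 (a - 2),
          (j : ℝ) * 2 ^ (2 * j) * lambdaSeries (2 * j + 1) * zetaSeries (2 * a - 2 * j) := by
  obtain ⟨k, rfl⟩ : ∃ k, a = k + 1 := ⟨a - 1, by omega⟩
  have hpred : 2 * (k + 1) - 1 = 2 * k + 1 := by omega
  have hk : 1 ≤ k := by omega
  rw [hpred]
  refine ⟨summable_sigmaTerm (by omega) le_rfl, ?_⟩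
  have zeta_two : zetaSeries 2 = 4 / 3 * lambdaSeries 2 := by
    linarith [lambdaSeries_add_zetaSeries_div_two_pow (s := 2) le_rfl]
  have top_term := sum_Icc_succ_top (show 1 ≤ k - 1 + 1 by omega) fun j : ℕ =>
    (j : ℝ) * 2 ^ (2 * j) * lambdaSeries (2 * j + 1) * zetaSeries (2 * (k + 1) - 2 * j)
  rw [Nat.sub_add_cancel hk, show 2 * (k + 1) - 2 * k = 2 by omega, zeta_two] at top_term
  rw [sigmaSum_two_mul_add_one_two hk, top_term, show k + 1 - 2 = k - 1 by omega,
    show 2 * (k + 1) + 1 = 2 * k + 3 by ring]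
  push_cast
  ring
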